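/- **Theorem (Higher regularity estimates).** Let $n\ge 2$, let $B_1\subset\mathbb R^n$ be the open unit ball centred at the origin, $0\le m<3$, $\alpha>-\tfrac43 m$ and $c_2>0$. Let $u\in C^0(B_1)$, $u\ge 0$, be a viscosity solution of $$\Delta_\infty u=f(x,u)\quad\text{in }B_1,\qquad \Delta_\infty u:=(Du)^T D^2u\,Du ,$$ that is, for every $y\in B_1$ and every $\varphi$ of class $C^2$ near $y$: if $u-\varphi$ has a local maximum at $y$, then $\Delta_\infty\varphi(y)\ge f(y,u(y))$; if $u-\varphi$ has a local minimum at $y$, then $\Delta_\infty\varphi(y)\le f(y,u(y))$. Let $x_0\in B_{1/2}\cap\partial\{u>0\}$ be a free boundary point such that $f(x,t)\simeq|x-x_0|^\alpha t_+^m$, i.e. for some $c_1>0$ $$c_1|x-x_0|^\alpha t^m\le f(x,t)\le c_2|x-x_0|^\alpha t^m\qquad\text{for all }x\in B_1\setminus\{x_0\},\ t>0,$$ while, for $x\in B_1\setminus\{x_0\}$, $f(x,0)=0$ if $m>0$ and $0\le f(x,0)\le c_2|x-x_0|^\alpha$ if $m=0$, and $f(x_0,0)=0$. Then: 1. For every $\eta>0$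 there is a constant $\mathrm C>0$, depending only on $n,m,\alpha,c_2$ and $\eta$, such that $$\sup_{B_r(x_0)}u\le \mathrm C\,r^{\frac{4+\alpha}{3-m}}\qquad\text{for all } r\in(0,\tfrac12)\text{ with } |x_0|+r\le 1-\eta .$$ 2. For every $M>0$ there is a constant $\mathrm C>0$, depending only on $n,m,\alpha,c_2$ and $M$, such that, if moreover $u\le M$ in $B_1$, then $$\sup_{B_r(x_0)}u\le \mathrm C\,r^{\frac{4+\alpha}{3-m}}\qquad\text{for all } r\in(0,\tfrac12).$$ -/

import Mathlib

/-- The infinity-Laplacian `(Dφ)ᵀ D²φ Dφ = ∑ i j, ∂ᵢφ ∂ᵢⱼφ ∂ⱼφ`, i.e. the second derivative of `φ`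
at `x` applied twice to the gradient of `φ` at `x`. -/
noncomputable def infLaplacian {n : ℕ} (φ : EuclideanSpace ℝ (Fin n) → ℝ)
    (x : EuclideanSpace ℝ (Fin n)) : ℝ :=
  fderiv ℝ (fderiv ℝ φ) x (gradient φ x) (gradient φ x)

/-- Viscosity sub-solution of `Δ∞ u = f(x, u)` in `Ω` (that is, `Δ∞ u ≥ f(x, u)`): whenever `φ` is
`C²` near `x ∈ Ω` and `u - φ` has a local maximum at `x`, then `Δ∞ φ(x) ≥ f(x, u(x))`.
(`Ω` is meant to be open. A function that is `C²` near `x` can be cut off to a globally `C²` one, so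
local and global test functions give the same notion.) -/
def IsViscositySubsolution {n : ℕ} (f : EuclideanSpace ℝ (Fin n) → ℝ → ℝ)
    (Ω : Set (EuclideanSpace ℝ (Fin n))) (u : EuclideanSpace ℝ (Fin n) → ℝ) : Prop :=
  ∀ x ∈ Ω, ∀ φ : EuclideanSpace ℝ (Fin n) → ℝ, ContDiffAt ℝ 2 φ x →
    IsLocalMax (fun y => u y - φ y) x → f x (u x) ≤ infLaplacian φ x

/-- Viscosity super-solution of `Δ∞ u = f(x, u)` in `Ω` (that is, `Δ∞ u ≤ f(x, u)`). -/
def IsViscositySupersolution {n : ℕ} (f : EuclideanSpace ℝ (Fin n) → ℝ → ℝ)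
    (Ω : Set (EuclideanSpace ℝ (Fin n))) (u : EuclideanSpace ℝ (Fin n) → ℝ) : Prop :=
  ∀ x ∈ Ω, ∀ φ : EuclideanSpace ℝ (Fin n) → ℝ, ContDiffAt ℝ 2 φ x →
    IsLocalMin (fun y => u y - φ y) x → infLaplacian φ x ≤ f x (u x)

/-- Continuous viscosity solution of `Δ∞ u = f(x, u)` in the open set `Ω`. -/
structure IsViscositySolution {n : ℕ} (f : EuclideanSpace ℝ (Fin n) → ℝ → ℝ)
    (Ω : Set (EuclideanSpace ℝ (Fin n))) (u : EuclideanSpace ℝ (Fin n) → ℝ) : Prop where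
  continuousOn : ContinuousOn u Ω
  sub : IsViscositySubsolution f Ω u
  super : IsViscositySupersolution f Ω u

/-- `f(x, t) ≃ |x - x₀|^α t₊^m` in the unit ball, with constants `c₁` (below) and `c₂` (above), for
the values `t ≥ 0` that a non-negative function takes. At `t = 0` one has `t₊^m = 0` if `m > 0`;
if `m = 0` both readings of `0₊^0` (`1`, or `0` for a source switched off on `{u = 0}`) are allowed,
as `f(x, 0)` may be anything between `0` and `c₂ |x - x₀|^α`. At the point `x₀`, where the weight may
be singular, only the value `f(x₀, 0) = 0` of the product is prescribed. -/
structure IsHardyHenonSource {n : ℕ} (f : EuclideanSpace ℝ (Fin n) → ℝ → ℝ)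
    (x₀ : EuclideanSpace ℝ (Fin n)) (α m c₁ c₂ : ℝ) : Prop where
  lower : ∀ x ∈ Metric.ball (0 : EuclideanSpace ℝ (Fin n)) 1, x ≠ x₀ →
    ∀ t : ℝ, 0 < t → c₁ * (‖x - x₀‖ ^ α * t ^ m) ≤ f x t
  upper : ∀ x ∈ Metric.ball (0 : EuclideanSpace ℝ (Fin n)) 1, x ≠ x₀ →
    ∀ t : ℝ, 0 < t → f x t ≤ c₂ * (‖x - x₀‖ ^ α * t ^ m)
  lower_zero : ∀ x ∈ Metric.ball (0 : EuclideanSpace ℝ (Fin n)) 1, x ≠ x₀ → 0 ≤ f x 0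
  upper_zero : ∀ x ∈ Metric.ball (0 : EuclideanSpace ℝ (Fin n)) 1, x ≠ x₀ →
    f x 0 ≤ if m = 0 then c₂ * ‖x - x₀‖ ^ α else 0
  center : f x₀ 0 = 0

/-- The free boundary points `B_{1/2} ∩ ∂{u > 0}` of a function `u` on the unit ball. -/
def freeBoundaryHalf {n : ℕ} (u : EuclideanSpace ℝ (Fin n) → ℝ) :
    Set (EuclideanSpace ℝ (Fin n)) :=
  Metric.ball 0 (1 / 2) ∩ frontier {x | x ∈ Metric.ball 0 1 ∧ 0 < u x}

/-! Fix d ≤ 1/12 and let S = u(y) be the maximum of u on the sphere |x - x₀| = d. As the source is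
nonnegative and u(x₀) = 0, comparison with cones gives u ≤ S|x - x₀|/d inside
(`exists_sphere_le_cone`). This linear decay tames the weight: |x - x₀|^α u^m ≤ (S/d)^m |x -
x₀|^(α+m), where α + m > -m/3 > -1.

A source with a singularity of order γ > -1 at x₀ is absorbed by a radial barrier centred at y. The
term |s - d|^(γ+2) in its profile has bounded slope, while its second derivative blows up like |s -
d|^γ on the sphere around y that passes through x₀. If S^(3-m) exceeds a fixed multiple of d^(4+α),
the barrier is a strict subsolution and forces u(x₀) ≥ S/4 > 0 (`le_of_dist_eq_of_supersolution`), a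
contradiction. This is `exists_growth_bound`.

For r ≥ 1/12 a plain bound on u suffices. It is M in the second claim. In the first, the same
barrier away from x₀ gives a Harnack alternative, iterated along segments towards x₀
(`exists_interior_bound`). The constant c₁ enters only through the sign of f. -/

/-! ### Infinity-Laplacian of radial functions. -/

theorem hasFDerivAt_radial {n : ℕ} {G : ℝ → ℝ} {x y : EuclideanSpace ℝ (Fin n)} (hxy : x ≠ y)
    (hG : DifferentiableAt ℝ G ‖x - y‖) :
    HasFDerivAt (fun z => G ‖z - y‖) ((deriv G ‖x - y‖ / ‖x - y‖) • innerSL ℝ (x - y)) x := by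
  have hs : ‖x - y‖ ≠ 0 := norm_ne_zero_iff.2 (sub_ne_zero.2 hxy)
  have h1 : HasFDerivAt (fun z : EuclideanSpace ℝ (Fin n) => ‖z - y‖ ^ 2)
      (2 • (innerSL ℝ (x - y)).comp (ContinuousLinearMap.id ℝ _)) x :=
    ((hasFDerivAt_id x).sub_const y).norm_sq
  have h2 := h1.sqrt (by positivity)
  simp only [Real.sqrt_sq (norm_nonneg _)] at h2
  have h3 := hG.hasDerivAt.comp_hasFDerivAt x h2
  refine h3.congr_fderiv ?_
  ext v
  simp
  field_simp

theorem contDiffAt_radial {n : ℕ} {G : ℝ → ℝ} {x y : EuclideanSpace ℝ (Fin n)} (hxy : x ≠ y)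
    (hG : ContDiffAt ℝ 2 G ‖x - y‖) : ContDiffAt ℝ 2 (fun z => G ‖z - y‖) x :=
  ContDiffAt.comp x hG ((contDiffAt_id.sub contDiffAt_const).norm ℝ (sub_ne_zero.2 hxy))

/-- With Φ = Dφ and v = ∇φ(x), this turns the infinity-Laplacian into a one-variable derivative. For
radial φ the line stays on the ray from the centre, so no Hessian has to be computed. -/
theorem hasDerivAt_apply_line {E : Type*} [NormedAddCommGroup E] [NormedSpace ℝ E]
    {Φ : E → E →L[ℝ] ℝ} {x v : E} (hΦ : DifferentiableAt ℝ Φ x) :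
    HasDerivAt (fun t : ℝ => Φ (x + t • v) v) (fderiv ℝ Φ x v v) 0 := by
  have hline : HasDerivAt (fun t : ℝ => x + t • v) v 0 := by
    simpa using ((hasDerivAt_id (0 : ℝ)).smul_const v).const_add x
  have h0 : HasFDerivAt Φ (fderiv ℝ Φ x) (x + (0 : ℝ) • v) := by
    simpa using hΦ.hasFDerivAt
  exact (ContinuousLinearMap.apply ℝ ℝ v).hasFDerivAt.comp_hasDerivAt 0
    (h0.comp_hasDerivAt 0 hline)

/-- The infinity-Laplacian of a radial function. -/
theorem infLaplacian_radial {n : ℕ} {G : ℝ → ℝ} {x y : EuclideanSpace ℝ (Fin n)} (hxy : x ≠ y)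
    (hG : ContDiffAt ℝ 2 G ‖x - y‖) :
    infLaplacian (fun z => G ‖z - y‖) x
      = deriv G ‖x - y‖ ^ 2 * deriv (deriv G) ‖x - y‖ := by
  have hs : 0 < ‖x - y‖ := norm_pos_iff.2 (sub_ne_zero.2 hxy)
  set s := ‖x - y‖ with hsdef
  set c := deriv G s / s with hc
  have hgrad : gradient (fun z => G ‖z - y‖) x = c • (x - y) := by
    refine HasGradientAt.gradient (hasGradientAt_iff_hasFDerivAt.2 ?_)
    refine (hasFDerivAt_radial hxy (hG.differentiableAt (by norm_num))).congr_fderiv ?_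
    ext v
    simp [hc, hsdef]
  have hdG : ∀ᶠ t in nhds s, DifferentiableAt ℝ G t :=
    (hG.eventually (by simp)).mono fun t ht => ht.differentiableAt (by norm_num)
  have hd1 : DifferentiableAt ℝ (deriv G) s := by
    have h : ContDiffAt ℝ 1 (fderiv ℝ G) s := hG.fderiv_right (by norm_num)
    exact (h.differentiableAt (by norm_num)).clm_apply (differentiableAt_const 1)
  have hφ : DifferentiableAt ℝ (fderiv ℝ (fun z => G ‖z - y‖)) x := by
    have h : ContDiffAt ℝ 1 (fderiv ℝ (fun z => G ‖z - y‖)) x :=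
      (contDiffAt_radial hxy hG).fderiv_right (by norm_num)
    exact h.differentiableAt (by norm_num)
  set v := c • (x - y) with hv
  have hA : HasDerivAt (fun t : ℝ => fderiv ℝ (fun z => G ‖z - y‖) (x + t • v) v)
      (fderiv ℝ (fderiv ℝ (fun z => G ‖z - y‖)) x v v) 0 := by
    exact hasDerivAt_apply_line hφ
  have hlin : HasDerivAt (fun t : ℝ => (1 + t * c) * s) (c * s) 0 := by
    simpa using (((hasDerivAt_id (0 : ℝ)).mul_const c).const_add 1).mul_const s
  have hB : HasDerivAt (fun t : ℝ => deriv G ((1 + t * c) * s) * (c * s))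
      (deriv (deriv G) s * (c * s) * (c * s)) 0 := by
    have h0 : HasDerivAt (deriv G) (deriv (deriv G) s) ((1 + 0 * c) * s) := by
      simpa using hd1.hasDerivAt
    exact (h0.comp 0 hlin).mul_const (c * s)
  have hpos : ∀ᶠ t in nhds (0 : ℝ), 0 < 1 + t * c := by
    have : ContinuousAt (fun t : ℝ => 1 + t * c) 0 := by fun_prop
    exact this.eventually (lt_mem_nhds (by simp))
  have hdG' : ∀ᶠ t in nhds (0 : ℝ), DifferentiableAt ℝ G ((1 + t * c) * s) := by
    have h := hlin.continuousAt
    refine h.eventually (p := fun w => DifferentiableAt ℝ G w) ?_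
    simpa using hdG
  have heq : (fun t : ℝ => fderiv ℝ (fun z => G ‖z - y‖) (x + t • v) v)
      =ᶠ[nhds 0] fun t : ℝ => deriv G ((1 + t * c) * s) * (c * s) := by
    filter_upwards [hpos, hdG'] with t ht hdt
    have e : x + t • v - y = (1 + t * c) • (x - y) := by
      rw [hv, smul_smul, add_smul, one_smul]; abel
    have en : ‖x + t • v - y‖ = (1 + t * c) * s := by
      rw [e, norm_smul, Real.norm_of_nonneg ht.le]
    have hne : x + t • v ≠ y := by
      intro h
      rw [h, sub_self, norm_zero] at en
      have := mul_pos ht hs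
      linarith
    rw [(hasFDerivAt_radial hne (by rwa [en])).fderiv, en, e]
    have hi : inner ℝ (x - y) (x - y) = s ^ 2 := real_inner_self_eq_norm_sq _
    simp only [smul_apply, innerSL_apply_apply, hv, inner_smul_left,
      inner_smul_right, hi, smul_eq_mul]
    simp only [conj_trivial]
    field_simp
  have := hA.unique (hB.congr_of_eventuallyEq heq)
  rw [infLaplacian, hgrad, this, hc]
  field_simp

/-! ### Comparison with cones. -/

/-- Comparison with cones from above for nonnegative infinity-subharmonic functions vanishing at the
vertex. -/
theorem exists_sphere_le_cone {n : ℕ} (hn : 1 ≤ n) {u : EuclideanSpace ℝ (Fin n) → ℝ}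
    {x₀ : EuclideanSpace ℝ (Fin n)} {d : ℝ} (hd : 0 < d)
    (hu : ContinuousOn u (Metric.closedBall x₀ d)) (hu0 : ∀ x ∈ Metric.closedBall x₀ d, 0 ≤ u x)
    (hx₀ : u x₀ = 0)
    (hsub : IsViscositySubsolution (fun _ _ => 0) (Metric.ball x₀ d) u) :
    ∃ y, ‖y - x₀‖ = d ∧ ∀ x ∈ Metric.closedBall x₀ d, u x ≤ u y * (‖x - x₀‖ / d) := by
  have : Nontrivial (EuclideanSpace ℝ (Fin n)) := by
    have : Nonempty (Fin n) := ⟨⟨0, hn⟩⟩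
    infer_instance
  obtain ⟨y, hy, hmax⟩ := (isCompact_sphere x₀ d).exists_isMaxOn
    (NormedSpace.sphere_nonempty.2 hd.le) (hu.mono Metric.sphere_subset_closedBall)
  have hyd : ‖y - x₀‖ = d := by simpa [dist_eq_norm] using hy
  refine ⟨y, hyd, ?_⟩
  set S := u y with hS
  have hS0 : 0 ≤ S := hu0 y (Metric.sphere_subset_closedBall hy)
  -- The cone is bent into a strictly concave, increasing profile with negative infinity-Laplacian.
  -- It vanishes at the vertex and equals S + e d / 2 on the sphere, so a positive maximum of the
  -- difference would be interior and contradict `hsub`. The cone is recovered as e → 0.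
  have key : ∀ e : ℝ, 0 < e → ∀ x ∈ Metric.closedBall x₀ d,
      u x ≤ (S / d + e) * ‖x - x₀‖ - e / (2 * d) * ‖x - x₀‖ ^ 2 := by
    intro e he
    by_contra! hcon
    obtain ⟨w, hw, hwlt⟩ := hcon
    set ψ : ℝ → ℝ := fun s => (S / d + e) * s - e / (2 * d) * s ^ 2 with hψ
    have hcont : ContinuousOn (fun x => u x - ψ ‖x - x₀‖) (Metric.closedBall x₀ d) := by
      refine hu.sub (Continuous.continuousOn ?_)
      simp only [hψ]
      fun_prop
    obtain ⟨x, hx, hxmax⟩ := (isCompact_closedBall x₀ d).exists_isMaxOn ⟨w, hw⟩ hcont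
    have hxpos : 0 < u x - ψ ‖x - x₀‖ := lt_of_lt_of_le (sub_pos.2 hwlt) (hxmax hw)
    have hxx : x ≠ x₀ := by
      rintro rfl
      simp [hψ, hx₀] at hxpos
    have hxd : ‖x - x₀‖ < d := by
      have hle : ‖x - x₀‖ ≤ d := by simpa [dist_eq_norm] using hx
      refine lt_of_le_of_ne hle fun h => ?_
      have h1 : u x ≤ S := hmax (by simpa [dist_eq_norm] using h)
      have h2 : ψ d = S + e * d / 2 := by simp only [hψ]; field_simp; ring
      rw [h, h2] at hxpos
      nlinarith [mul_pos he hd]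
    have hxb : x ∈ Metric.ball x₀ d := by simpa [dist_eq_norm] using hxd
    have hloc : IsLocalMax (fun z => u z - ψ ‖z - x₀‖) x :=
      hxmax.isLocalMax (Filter.mem_of_superset (Metric.isOpen_ball.mem_nhds hxb)
        Metric.ball_subset_closedBall)
    have hψC : ContDiffAt ℝ 2 ψ ‖x - x₀‖ := by simp only [hψ]; fun_prop
    have h := hsub x hxb _ (contDiffAt_radial hxx hψC) hloc
    rw [infLaplacian_radial hxx hψC] at h
    have hd1 : deriv ψ = fun s => (S / d + e) - e / d * s := by
      funext s
      have : HasDerivAt ψ ((S / d + e) * 1 - e / (2 * d) * (2 * s)) s := by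
        have h1 := (hasDerivAt_id s).const_mul (S / d + e)
        have h2 := ((hasDerivAt_pow 2 s).const_mul (e / (2 * d)))
        exact (h1.sub h2).congr_deriv (by simp)
      rw [this.deriv]
      field_simp
    have hd2 : deriv (deriv ψ) ‖x - x₀‖ = - (e / d) := by
      rw [hd1]
      simp
    rw [hd2, hd1] at h
    have hp : 0 < (S / d + e) - e / d * ‖x - x₀‖ := by
      have h1 : e / d * ‖x - x₀‖ < e / d * d := by gcongr
      have h2 : e / d * d = e := by field_simp
      have h3 : 0 ≤ S / d := by positivity
      linarith
    have : 0 < ((S / d + e) - e / d * ‖x - x₀‖) ^ 2 * (e / d) := by positivity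
    simp only at h
    linarith
  intro x hx
  have hlim : Filter.Tendsto
      (fun e : ℝ => (S / d + e) * ‖x - x₀‖ - e / (2 * d) * ‖x - x₀‖ ^ 2)
      (nhdsWithin 0 (Set.Ioi 0)) (nhds (S * (‖x - x₀‖ / d))) := by
    have hc : Continuous (fun e : ℝ => (S / d + e) * ‖x - x₀‖ - e / (2 * d) * ‖x - x₀‖ ^ 2) := by
      fun_prop
    have := hc.tendsto 0
    refine (this.mono_left nhdsWithin_le_nhds).trans_eq ?_ |>.trans le_rfl
    congr 1
    ring
  exact ge_of_tendsto hlim (Filter.eventually_of_mem self_mem_nhdsWithin fun e he => key e he x hx)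

/-! ### The singular barrier. -/

theorem hasDerivAt_abs_rpow_of_ne {σ t : ℝ} (ht : t ≠ 0) :
    HasDerivAt (fun t : ℝ => |t| ^ σ) (σ * |t| ^ (σ - 1) * SignType.sign t) t := by
  have h := (hasDerivAt_abs ht).rpow_const (p := σ) (Or.inl (abs_ne_zero.2 ht))
  convert h using 1
  ring

theorem hasDerivAt_deriv_abs_rpow {σ t : ℝ} (ht : t ≠ 0) :
    HasDerivAt (deriv fun t : ℝ => |t| ^ σ) (σ * (σ - 1) * |t| ^ (σ - 2)) t := by
  have h0 : (deriv fun t : ℝ => |t| ^ σ)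
      =ᶠ[nhds t] fun s => σ * |s| ^ (σ - 1) * (SignType.sign t : ℝ) := by
    have hsgn : ∀ᶠ s in nhds t, s ≠ 0 ∧ SignType.sign s = SignType.sign t := by
      rcases lt_or_gt_of_ne ht with h | h
      · filter_upwards [Iio_mem_nhds h] with s hs
        exact ⟨ne_of_lt hs, by rw [sign_neg h, sign_neg hs]⟩
      · filter_upwards [Ioi_mem_nhds h] with s hs
        exact ⟨ne_of_gt hs, by rw [sign_pos h, sign_pos hs]⟩
    filter_upwards [hsgn] with s hs
    rw [(hasDerivAt_abs_rpow_of_ne hs.1).deriv, hs.2]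
  refine HasDerivAt.congr_of_eventuallyEq ?_ h0
  have h1 := ((hasDerivAt_abs_rpow_of_ne (σ := σ - 1) ht).const_mul σ).mul_const (SignType.sign t : ℝ)
  refine h1.congr_deriv ?_
  have e : (SignType.sign t : ℝ) * SignType.sign t = 1 := by
    rcases lt_or_gt_of_ne ht with h | h
    · simp [sign_neg h]
    · simp [sign_pos h]
  rw [show σ - 1 - 1 = σ - 2 by ring]
  linear_combination (σ * (σ - 1) * |t| ^ (σ - 2)) * e

/-- For `σ < 2`, the function `|t|^σ` lies above any parabola `L t²` near the origin. -/
theorem eventually_mul_sq_le_abs_rpow {σ : ℝ} (hσ0 : 0 < σ) (hσ : σ < 2) (L : ℝ) :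
    ∀ᶠ t in nhds (0 : ℝ), L * t ^ 2 ≤ |t| ^ σ := by
  have hc : ContinuousAt (fun t : ℝ => L * |t| ^ (2 - σ)) 0 :=
    continuousAt_const.mul (continuous_abs.continuousAt.rpow_const (Or.inr (by linarith)))
  have h1 : ∀ᶠ t in nhds (0 : ℝ), L * |t| ^ (2 - σ) < 1 := by
    refine hc.eventually (gt_mem_nhds ?_)
    simp [Real.zero_rpow (by linarith : 2 - σ ≠ 0)]
  filter_upwards [h1] with t ht
  rcases eq_or_ne t 0 with rfl | h0
  · simp [Real.zero_rpow hσ0.ne']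
  have hp : 0 < |t| := abs_pos.2 h0
  have e : t ^ 2 = |t| ^ (2 - σ) * |t| ^ σ := by
    rw [← Real.rpow_add hp, sub_add_cancel, ← sq_abs]
    norm_cast
  rw [e, ← mul_assoc]
  have := Real.rpow_nonneg hp.le σ
  nlinarith

/-- A nonnegative supersolution whose right-hand side is small compared with its value `S` at `y`
stays above `S / 4` at distance `d` from `y`. The right-hand side may be singular on the sphere of
radius `d`. -/
theorem le_of_dist_eq_of_supersolution {n : ℕ} {u F : EuclideanSpace ℝ (Fin n) → ℝ}
    {y : EuclideanSpace ℝ (Fin n)} {d σ K : ℝ} (hd : 0 < d) (hσ1 : 1 < σ) (hσ2 : σ < 2)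
    (hu : ContinuousOn u (Metric.closedBall y (4 * d)))
    (hu0 : ∀ x ∈ Metric.closedBall y (4 * d), 0 ≤ u x) (hS : 0 < u y)
    (hsuper : ∀ x ∈ Metric.ball y (4 * d), u x < u y →
      ∀ φ : EuclideanSpace ℝ (Fin n) → ℝ, ContDiffAt ℝ 2 φ x →
      IsLocalMin (fun z => u z - φ z) x → infLaplacian φ x ≤ F x)
    (hF : ∀ x ∈ Metric.ball y (4 * d), u x < u y → ‖x - y‖ ≠ d →
      F x ≤ K * |‖x - y‖ - d| ^ (σ - 2))
    (hK : K < σ * (σ - 1) / 384 * u y ^ 3 / d ^ (2 + σ))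
    {x : EuclideanSpace ℝ (Fin n)} (hx : ‖x - y‖ = d) : u y / 4 ≤ u x := by
  set S := u y with hSdef
  have hdσ : 0 < d ^ σ := Real.rpow_pos_of_pos hd σ
  -- The factor 24 makes the slope of the singular term at most 6τd^(σ-1) = S/(4d), half the linear
  -- slope S/(2d). It also keeps g ≤ S on [0, 4d], g(d) ≥ S/4 and g(4d) < 0.
  set τ := S / (24 * d ^ σ) with hτ
  have hτ0 : 0 < τ := by positivity
  have hτd : τ * d ^ σ = S / 24 := by rw [hτ]; field_simp
  have h3d : (3 * d) ^ σ ≤ 9 * d ^ σ := by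
    rw [Real.mul_rpow (by norm_num) hd.le]
    have : (3 : ℝ) ^ σ ≤ 3 ^ (2 : ℝ) := Real.rpow_le_rpow_of_exponent_le (by norm_num) hσ2.le
    norm_num at this
    gcongr
  have habs : ∀ s, 0 ≤ s → s ≤ 4 * d → |s - d| ≤ 3 * d := fun s h1 h2 =>
    abs_le.2 ⟨by linarith, by linarith⟩
  set g : ℝ → ℝ := fun s => S - S / (2 * d) * s + τ * (|s - d| ^ σ - d ^ σ) with hg
  have hgS : ∀ s, 0 ≤ s → s ≤ 4 * d → g s ≤ S := by
    intro s h1 h2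
    simp only [hg, mul_sub, hτd]
    have hSs : 0 ≤ S / (2 * d) * s := by positivity
    rcases le_total s (2 * d) with h | h
    · have : |s - d| ^ σ ≤ d ^ σ :=
        Real.rpow_le_rpow (abs_nonneg _) (abs_le.2 ⟨by linarith, by linarith⟩) (by linarith)
      have := mul_le_mul_of_nonneg_left this hτ0.le
      linarith
    · have : |s - d| ^ σ ≤ 9 * d ^ σ :=
        (Real.rpow_le_rpow (abs_nonneg _) (habs s h1 h2) (by linarith)).trans h3d
      have := mul_le_mul_of_nonneg_left this hτ0.le
      have h4 : S / (2 * d) * (2 * d) ≤ S / (2 * d) * s := by gcongr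
      have h5 : S / (2 * d) * (2 * d) = S := by field_simp
      nlinarith
  have hg0 : g 0 = S := by simp [hg, abs_of_pos hd]
  have hgd : S / 4 ≤ g d := by
    simp only [hg, sub_self, abs_zero, Real.zero_rpow (by linarith : σ ≠ 0), mul_sub, hτd]
    have h5 : S / (2 * d) * d = S / 2 := by field_simp
    linarith
  have hg4 : g (4 * d) < 0 := by
    simp only [hg, mul_sub, hτd]
    rw [show 4 * d - d = 3 * d by ring, abs_of_pos (by positivity : 0 < 3 * d)]
    have h5 : S / (2 * d) * (4 * d) = 2 * S := by field_simp; norm_num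
    have := mul_le_mul_of_nonneg_left h3d hτ0.le
    nlinarith
  have hgc : Continuous g := by
    have : Continuous fun s : ℝ => |s - d| ^ σ :=
      (continuous_abs.comp (continuous_id.sub continuous_const)).rpow_const
        fun _ => Or.inr (by linarith)
    simp only [hg]
    fun_prop
  suffices key : ∀ z ∈ Metric.closedBall y (4 * d), g ‖z - y‖ ≤ u z by
    have h := key x (by rw [Metric.mem_closedBall, dist_eq_norm, hx]; linarith)
    rw [hx] at h
    exact hgd.trans h
  by_contra! hcon
  obtain ⟨w, hw, hwlt⟩ := hcon
  have hcont : ContinuousOn (fun z => u z - g ‖z - y‖) (Metric.closedBall y (4 * d)) :=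
    hu.sub (hgc.comp (continuous_id.sub continuous_const).norm).continuousOn
  obtain ⟨z, hz, hzmin⟩ := (isCompact_closedBall y (4 * d)).exists_isMinOn ⟨w, hw⟩ hcont
  have hzneg : u z - g ‖z - y‖ < 0 := lt_of_le_of_lt (hzmin hw) (sub_neg.2 hwlt)
  have hzle : ‖z - y‖ ≤ 4 * d := by simpa [dist_eq_norm] using hz
  have hzy : z ≠ y := by
    rintro rfl
    simp [hg0, hSdef] at hzneg
  have hzlt : ‖z - y‖ < 4 * d := by
    refine lt_of_le_of_ne hzle fun h => ?_
    rw [h] at hzneg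
    linarith [hu0 z hz]
  -- Since g ≤ S, contact occurs where u < S, the only place where the source has to be controlled.
  have hzS : u z < S := by linarith [hgS _ (norm_nonneg (z - y)) hzle]
  have hzb : z ∈ Metric.ball y (4 * d) := by simpa [dist_eq_norm] using hzlt
  have hloc : IsLocalMin (fun z => u z - g ‖z - y‖) z :=
    hzmin.isLocalMin (Filter.mem_of_superset (Metric.isOpen_ball.mem_nhds hzb)
      Metric.ball_subset_closedBall)
  by_cases hsd : ‖z - y‖ = d
  -- On the critical sphere g is not C². Because σ < 2, any parabola in s - d may replace the
  -- singular term and still touch from below; L is chosen so that the infinity-Laplacian equals |F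
  -- z| + 1, whatever F is there.
  · set L := (|F z| + 1) / (2 * τ * (S / (2 * d)) ^ 2) with hL
    set P : ℝ → ℝ := fun s => S - S / (2 * d) * s + τ * (L * (s - d) ^ 2 - d ^ σ) with hP
    have hPC : ContDiffAt ℝ 2 P ‖z - y‖ := by simp only [hP]; fun_prop
    have hle : ∀ᶠ v in nhds z, P ‖v - y‖ ≤ g ‖v - y‖ := by
      have ht : Filter.Tendsto (fun v => ‖v - y‖ - d) (nhds z) (nhds 0) := by
        have : Continuous fun v => ‖v - y‖ - d := by fun_prop
        simpa [hsd] using this.tendsto z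
      filter_upwards [ht.eventually
        (eventually_mul_sq_le_abs_rpow (by linarith : 0 < σ) hσ2 L)] with v hv
      simp only [hP, hg]
      gcongr
    have hPg : P ‖z - y‖ = g ‖z - y‖ := by
      simp [hP, hg, hsd, Real.zero_rpow (by linarith : σ ≠ 0)]
    have hloc' : IsLocalMin (fun z => u z - P ‖z - y‖) z := by
      filter_upwards [hloc, hle] with v h1 h2
      have h3 : u z - g ‖z - y‖ ≤ u v - g ‖v - y‖ := h1
      change u z - P ‖z - y‖ ≤ u v - P ‖v - y‖
      linarith
    have h := hsuper z hzb hzS _ (contDiffAt_radial hzy hPC) hloc'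
    rw [infLaplacian_radial hzy hPC, hsd] at h
    have hd1 : deriv P = fun s => - (S / (2 * d)) + τ * (L * (2 * (s - d))) := by
      funext s
      have h1 := ((hasDerivAt_id s).const_mul (S / (2 * d))).const_sub S
      have h2 := ((((((hasDerivAt_id s).sub_const d).pow 2).const_mul L).sub_const
        (d ^ σ)).const_mul τ)
      have h3 : HasDerivAt P (-(S / (2 * d)) + τ * (L * (2 * (s - d)))) s :=
        (h1.add h2).congr_deriv (by simp)
      exact h3.deriv
    have hd2 : deriv (deriv P) d = τ * (L * 2) := by
      rw [hd1]
      simp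
    rw [hd2, hd1] at h
    have e : (-(S / (2 * d)) + τ * (L * (2 * (d - d)))) ^ 2 * (τ * (L * 2)) = |F z| + 1 := by
      rw [hL]
      field_simp
      ring
    simp only [e] at h
    linarith [le_abs_self (F z)]
  · have hne : ‖z - y‖ - d ≠ 0 := sub_ne_zero.2 hsd
    set t := ‖z - y‖ with ht
    have hgder : ∀ s, s ≠ d → HasDerivAt g
        (-(S / (2 * d)) + τ * deriv (fun t : ℝ => |t| ^ σ) (s - d)) s := by
      intro s hs
      have h1 := ((hasDerivAt_id s).const_mul (S / (2 * d))).const_sub S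
      have hq := (hasDerivAt_abs_rpow_of_ne (σ := σ) (sub_ne_zero.2 hs)).differentiableAt.hasDerivAt
      have h2 := ((hq.comp_sub_const s d).sub_const (d ^ σ)).const_mul τ
      exact (h1.add h2).congr_deriv (by simp)
    have hgder2 : HasDerivAt (deriv g) (τ * (σ * (σ - 1) * |t - d| ^ (σ - 2))) t := by
      have he : deriv g =ᶠ[nhds t]
          fun s => -(S / (2 * d)) + τ * deriv (fun t : ℝ => |t| ^ σ) (s - d) := by
        filter_upwards [isOpen_ne.mem_nhds hsd] with s hs
        exact (hgder s hs).deriv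
      refine HasDerivAt.congr_of_eventuallyEq ?_ he
      exact (((hasDerivAt_deriv_abs_rpow (σ := σ) hne).comp_sub_const t d).const_mul
        τ).const_add _
    have hgC : ContDiffAt ℝ 2 g t := by
      have h1 : ContDiffAt ℝ 2 (fun s : ℝ => |s - d| ^ σ) t :=
        ((contDiffAt_id.sub contDiffAt_const).abs hne).rpow_const_of_ne (abs_ne_zero.2 hne)
      simp only [hg]
      fun_prop
    have h := hsuper z hzb hzS _ (contDiffAt_radial hzy hgC) hloc
    rw [infLaplacian_radial hzy hgC, hgder2.deriv, (hgder _ hsd).deriv,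
      (hasDerivAt_abs_rpow_of_ne hne).deriv] at h
    have hFz := hF z hzb hzS hsd
    have hapos : 0 < |t - d| := abs_pos.2 hne
    have hw0 : 0 < |t - d| ^ (σ - 2) := Real.rpow_pos_of_pos hapos _
    -- the slope of the barrier is at most `-S / (4 d)`
    have hslope : |τ * (σ * |t - d| ^ (σ - 1) * (SignType.sign (t - d) : ℝ))| ≤ S / (4 * d) := by
      have hsg : |(SignType.sign (t - d) : ℝ)| ≤ 1 := by
        rcases lt_or_gt_of_ne hne with h | h
        · simp [sign_neg h]
        · simp [sign_pos h]
      have h1 : |t - d| ^ (σ - 1) ≤ 3 * d ^ (σ - 1) := by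
        refine (Real.rpow_le_rpow hapos.le (habs t (norm_nonneg _) hzle) (by linarith)).trans ?_
        rw [Real.mul_rpow (by norm_num) hd.le]
        have : (3 : ℝ) ^ (σ - 1) ≤ 3 ^ (1 : ℝ) :=
          Real.rpow_le_rpow_of_exponent_le (by norm_num) (by linarith)
        rw [Real.rpow_one] at this
        gcongr
      have h2 : d ^ (σ - 1) = d ^ σ / d := by rw [Real.rpow_sub hd, Real.rpow_one]
      rw [abs_mul, abs_mul, abs_mul, abs_of_pos hτ0, abs_of_pos (by linarith : 0 < σ),
        abs_of_nonneg (Real.rpow_nonneg hapos.le _)]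
      calc τ * (σ * |t - d| ^ (σ - 1) * |(SignType.sign (t - d) : ℝ)|)
          ≤ τ * (2 * (3 * d ^ (σ - 1)) * 1) := by gcongr
        _ = S / (4 * d) := by rw [h2, hτ]; field_simp; norm_num
    have hsq : (S / (4 * d)) ^ 2 ≤ (-(S / (2 * d)) +
        τ * (σ * |t - d| ^ (σ - 1) * (SignType.sign (t - d) : ℝ))) ^ 2 := by
      rw [sq_le_sq, abs_of_pos (by positivity : 0 < S / (4 * d))]
      have e : S / (2 * d) = 2 * (S / (4 * d)) := by field_simp; norm_num
      rw [e]
      exact le_abs.2 (Or.inr (by linarith [(abs_le.1 hslope).2]))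
    have hσσ : 0 < σ * (σ - 1) := mul_pos (by linarith) (by linarith)
    have hlow : (S / (4 * d)) ^ 2 * (τ * (σ * (σ - 1) * |t - d| ^ (σ - 2))) ≤ F z :=
      (mul_le_mul_of_nonneg_right hsq (by positivity)).trans h
    have hdd : d ^ (2 + σ) = d ^ 2 * d ^ σ := by
      rw [Real.rpow_add hd]
      norm_cast
    -- The constant is 384 = 4² · 24.
    have e : (S / (4 * d)) ^ 2 * (τ * (σ * (σ - 1) * |t - d| ^ (σ - 2)))
        = (σ * (σ - 1) / 384 * S ^ 3 / d ^ (2 + σ)) * |t - d| ^ (σ - 2) := by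
      rw [hdd, hτ]
      field_simp
      ring
    rw [e] at hlow
    have := mul_lt_mul_of_pos_right hK hw0
    linarith

/-! ### Growth at the free boundary point. -/

theorem apply_eq_zero_of_mem_freeBoundaryHalf {n : ℕ} {u : EuclideanSpace ℝ (Fin n) → ℝ}
    (hu : ContinuousOn u (Metric.ball 0 1)) (hu0 : ∀ x ∈ Metric.ball 0 1, 0 ≤ u x)
    {x₀ : EuclideanSpace ℝ (Fin n)} (hx₀ : x₀ ∈ freeBoundaryHalf u) : u x₀ = 0 := by
  have hb : x₀ ∈ Metric.ball (0 : EuclideanSpace ℝ (Fin n)) 1 :=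
    Metric.ball_subset_ball (by norm_num) hx₀.1
  refine le_antisymm (not_lt.1 fun hpos => hx₀.2.2 ?_) (hu0 x₀ hb)
  have hnhds := Metric.isOpen_ball.mem_nhds hb
  rw [mem_interior_iff_mem_nhds]
  filter_upwards [hnhds, (hu.continuousAt hnhds).eventually (lt_mem_nhds hpos)] with x h1 h2
  exact ⟨h1, h2⟩

theorem IsHardyHenonSource.le_of_nonneg {n : ℕ} {f : EuclideanSpace ℝ (Fin n) → ℝ → ℝ}
    {x₀ : EuclideanSpace ℝ (Fin n)} {α m c₁ c₂ : ℝ} (hf : IsHardyHenonSource f x₀ α m c₁ c₂)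
    {x : EuclideanSpace ℝ (Fin n)} (hx : x ∈ Metric.ball 0 1) (hxx : x ≠ x₀) {t : ℝ}
    (ht : 0 ≤ t) : f x t ≤ c₂ * (‖x - x₀‖ ^ α * t ^ m) := by
  rcases ht.eq_or_lt with rfl | ht
  -- For m = 0 the convention 0 ^ 0 = 1 of `Real.rpow` matches the larger admissible value at t = 0.
  · refine (hf.upper_zero x hx hxx).trans ?_
    split_ifs with h
    · simp [h]
    · simp [Real.zero_rpow h]
  · exact hf.upper x hx hxx t ht

theorem IsHardyHenonSource.apply_nonneg {n : ℕ} {f : EuclideanSpace ℝ (Fin n) → ℝ → ℝ}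
    {x₀ : EuclideanSpace ℝ (Fin n)} {α m c₁ c₂ : ℝ} (hf : IsHardyHenonSource f x₀ α m c₁ c₂)
    (hc₁ : 0 < c₁) {u : EuclideanSpace ℝ (Fin n) → ℝ} (hux₀ : u x₀ = 0)
    {x : EuclideanSpace ℝ (Fin n)} (hx : x ∈ Metric.ball 0 1) (hux : 0 ≤ u x) :
    0 ≤ f x (u x) := by
  rcases eq_or_ne x x₀ with rfl | hxx
  · rw [hux₀, hf.center]
  rcases hux.eq_or_lt with h | h
  · rw [← h]
    exact hf.lower_zero x hx hxx
  · exact le_trans (by positivity) (hf.lower x hx hxx _ h)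

theorem lt_rpow_of_rpow_inv_lt {Q S q : ℝ} (hQ : 0 ≤ Q) (hq : 0 < q) (h : Q ^ q⁻¹ < S) :
    Q < S ^ q := by
  have := Real.rpow_lt_rpow (Real.rpow_nonneg hQ _) h hq
  rwa [Real.rpow_inv_rpow hQ hq.ne'] at this

/-- Growth of order `(4 + α) / (3 - m)` on small balls centred at the free boundary point. -/
theorem exists_growth_bound {n : ℕ} (hn : 1 ≤ n) {m α c₂ : ℝ} (hm0 : 0 ≤ m) (hm3 : m < 3)
    (hα : -(4 / 3) * m < α) (hc₂ : 0 < c₂) :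
    ∃ C : ℝ, 0 < C ∧ ∀ c₁ : ℝ, 0 < c₁ →
      ∀ (f : EuclideanSpace ℝ (Fin n) → ℝ → ℝ) (u : EuclideanSpace ℝ (Fin n) → ℝ),
      IsViscositySolution f (Metric.ball 0 1) u →
      (∀ x ∈ Metric.ball (0 : EuclideanSpace ℝ (Fin n)) 1, 0 ≤ u x) →
      ∀ x₀ ∈ freeBoundaryHalf u, IsHardyHenonSource f x₀ α m c₁ c₂ →
      ∀ d : ℝ, 0 < d → d ≤ 1 / 12 →
      ∀ x ∈ Metric.closedBall x₀ d, u x ≤ C * d ^ ((4 + α) / (3 - m)) := by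
  -- The cap -1/2 keeps σ = γ + 2 strictly between 1 and 2; the excess p = α + m - γ ≥ 0 is
  -- harmless.
  obtain ⟨γ, hγ1, hγ0, hγ⟩ : ∃ γ : ℝ, -1 < γ ∧ γ < 0 ∧ γ ≤ α + m :=
    ⟨min (α + m) (-1 / 2), lt_min (by linarith) (by norm_num),
      (min_le_right _ _).trans_lt (by norm_num), min_le_left _ _⟩
  have hk : 0 < (γ + 2) * (γ + 2 - 1) / 384 :=
    div_pos (mul_pos (by linarith) (by linarith)) (by norm_num)
  set k := (γ + 2) * (γ + 2 - 1) / 384 with hkdef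
  set p := α + m - γ with hp
  have hp0 : 0 ≤ p := by linarith
  set Q := c₂ * 5 ^ p / k with hQ
  have hQ0 : 0 < Q := by positivity
  have hq : 0 < 3 - m := by linarith
  refine ⟨Q ^ (3 - m)⁻¹, by positivity, ?_⟩
  intro c₁ hc₁ f u hu hu0 x₀ hx₀ hf d hd hd12 x hx
  have hux₀ := apply_eq_zero_of_mem_freeBoundaryHalf hu.continuousOn hu0 hx₀
  have hx₀h : ‖x₀‖ < 1 / 2 := by simpa using hx₀.1
  have hsub1 : Metric.closedBall x₀ d ⊆ Metric.ball 0 1 := by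
    intro z hz
    have hz' : ‖z - x₀‖ ≤ d := by simpa [dist_eq_norm] using hz
    have := norm_le_norm_add_norm_sub' z x₀
    rw [mem_ball_zero_iff]
    linarith
  obtain ⟨y, hyd, hcone⟩ := exists_sphere_le_cone hn hd (hu.continuousOn.mono hsub1)
    (fun z hz => hu0 z (hsub1 hz)) hux₀ (fun z hz φ hφ hmax => by
      have hz' := hsub1 (Metric.ball_subset_closedBall hz)
      exact (hf.apply_nonneg hc₁ hux₀ hz' (hu0 z hz')).trans (hu.sub z hz' φ hφ hmax))
  have hyb : y ∈ Metric.closedBall x₀ d := by simp [dist_eq_norm, hyd]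
  -- Here d ≤ 1/12 is used: 1/2 + d + 4d ≤ 11/12.
  have hsub4 : Metric.closedBall y (4 * d) ⊆ Metric.ball 0 1 := by
    intro z hz
    have hz' : ‖z - y‖ ≤ 4 * d := by simpa [dist_eq_norm] using hz
    have h1 := norm_le_norm_add_norm_sub' z y
    have h2 := norm_le_norm_add_norm_sub' y x₀
    rw [mem_ball_zero_iff]
    linarith
  have hSnn : 0 ≤ u y := hu0 y (hsub1 hyb)
  have hxle : u x ≤ u y := by
    refine (hcone x hx).trans (mul_le_of_le_one_right hSnn ?_)
    rw [div_le_one hd]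
    simpa [dist_eq_norm] using hx
  refine hxle.trans ?_
  have hpow : Q ^ (3 - m)⁻¹ * d ^ ((4 + α) / (3 - m)) = (Q * d ^ (4 + α)) ^ (3 - m)⁻¹ := by
    rw [Real.mul_rpow hQ0.le (by positivity), ← Real.rpow_mul hd.le, div_eq_mul_inv]
  rw [hpow]
  by_contra! hcon
  have hS : 0 < u y := lt_of_le_of_lt (by positivity) hcon
  have hSq := lt_rpow_of_rpow_inv_lt (by positivity) hq hcon
  have hSm : 0 < u y ^ m := Real.rpow_pos_of_pos hS m
  have hxy : ‖x₀ - y‖ = d := by rw [norm_sub_rev, hyd]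
  -- This is u(y)^(3-m) > Q d^(4+α) rearranged, which dictates the choice of Q.
  have hK : c₂ * 5 ^ p * u y ^ m * d ^ (α - γ)
      < (γ + 2) * (γ + 2 - 1) / 384 * u y ^ 3 / d ^ (2 + (γ + 2)) := by
    rw [← hkdef, lt_div_iff₀ (by positivity)]
    have e1 : d ^ (α - γ) * d ^ (2 + (γ + 2)) = d ^ (4 + α) := by
      rw [← Real.rpow_add hd]
      congr 1
      ring
    have e2 : u y ^ 3 = u y ^ (3 - m) * u y ^ m := by
      rw [← Real.rpow_add hS, sub_add_cancel]
      norm_cast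
    calc c₂ * 5 ^ p * u y ^ m * d ^ (α - γ) * d ^ (2 + (γ + 2))
        = k * (Q * d ^ (4 + α)) * u y ^ m := by
          rw [mul_assoc _ (d ^ (α - γ)), e1, hQ]
          field_simp
      _ < k * u y ^ (3 - m) * u y ^ m := by gcongr
      _ = k * u y ^ 3 := by rw [e2]; ring
  have := le_of_dist_eq_of_supersolution (F := fun z => f z (u z)) hd (by linarith : 1 < γ + 2)
    (by linarith) (hu.continuousOn.mono hsub4) (fun z hz => hu0 z (hsub4 hz)) hS
    (fun z hz _ φ hφ hmin => hu.super z (hsub4 (Metric.ball_subset_closedBall hz)) φ hφ hmin)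
    (fun z hz hzS hzd => ?_) hK hxy
  · rw [hux₀] at this
    linarith
  have hz1 := hsub4 (Metric.ball_subset_closedBall hz)
  have hzx : z ≠ x₀ := by
    rintro rfl
    exact hzd hxy
  have hρ : 0 < ‖z - x₀‖ := norm_pos_iff.2 (sub_ne_zero.2 hzx)
  have hz4 : ‖z - y‖ < 4 * d := by simpa [dist_eq_norm] using hz
  have hρ5 : ‖z - x₀‖ ≤ 5 * d := by
    have := norm_sub_le_norm_sub_add_norm_sub z y x₀
    linarith
  have hρs : |‖z - y‖ - d| ≤ ‖z - x₀‖ := by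
    have := abs_norm_sub_norm_le (z - y) (x₀ - y)
    rwa [hxy, sub_sub_sub_cancel_right] at this
  have hsd : 0 < |‖z - y‖ - d| := abs_pos.2 (sub_ne_zero.2 hzd)
  -- Beyond distance d the cone exceeds u(y), so the restriction u z < u y extends the linear bound
  -- to the whole ball.
  have hlin : u z ≤ u y * (‖z - x₀‖ / d) := by
    rcases le_total ‖z - x₀‖ d with h | h
    · exact hcone z (by simpa [dist_eq_norm] using h)
    · exact hzS.le.trans (le_mul_of_one_le_right hSnn ((one_le_div hd).2 h))
  have hum : u z ^ m ≤ u y ^ m * (‖z - x₀‖ ^ m / d ^ m) := by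
    refine (Real.rpow_le_rpow (hu0 z hz1) hlin hm0).trans_eq ?_
    rw [Real.mul_rpow hSnn (by positivity), Real.div_rpow hρ.le hd.le]
  -- Since γ < 0, the point singularity at x₀ is dominated by the singularity on the sphere around y
  -- through x₀.
  have hγs : ‖z - x₀‖ ^ γ ≤ |‖z - y‖ - d| ^ γ :=
    Real.rpow_le_rpow_of_nonpos hsd hρs hγ0.le
  have hpp : ‖z - x₀‖ ^ p ≤ 5 ^ p * d ^ p := by
    rw [← Real.mul_rpow (by norm_num) hd.le]
    exact Real.rpow_le_rpow hρ.le hρ5 hp0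
  have e3 : ‖z - x₀‖ ^ α * ‖z - x₀‖ ^ m = ‖z - x₀‖ ^ γ * ‖z - x₀‖ ^ p := by
    rw [← Real.rpow_add hρ, ← Real.rpow_add hρ, hp]
    congr 1
    ring
  have e4 : d ^ p = d ^ (α - γ) * d ^ m := by
    rw [← Real.rpow_add hd, hp]
    congr 1
    ring
  have hdm : 0 < d ^ m := Real.rpow_pos_of_pos hd m
  rw [add_sub_cancel_right]
  calc f z (u z) ≤ c₂ * (‖z - x₀‖ ^ α * u z ^ m) := hf.le_of_nonneg hz1 hzx (hu0 z hz1)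
    _ ≤ c₂ * (‖z - x₀‖ ^ α * (u y ^ m * (‖z - x₀‖ ^ m / d ^ m))) := by gcongr
    _ = c₂ * u y ^ m * (‖z - x₀‖ ^ α * ‖z - x₀‖ ^ m) / d ^ m := by ring
    _ = c₂ * u y ^ m * (‖z - x₀‖ ^ γ * ‖z - x₀‖ ^ p) / d ^ m := by rw [e3]
    _ ≤ c₂ * u y ^ m * (|‖z - y‖ - d| ^ γ * (5 ^ p * d ^ p)) / d ^ m := by gcongr
    _ = c₂ * 5 ^ p * u y ^ m * d ^ (α - γ) * |‖z - y‖ - d| ^ γ := by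
        rw [e4]
        field_simp

/-! ### Bounds away from the free boundary point. -/

/-- Harnack-type alternative at points away from the free boundary point. -/
theorem exists_harnack_threshold {n : ℕ} {m α c₂ h : ℝ} (hm0 : 0 ≤ m) (hm3 : m < 3)
    (hc₂ : 0 < c₂) (hh : 0 < h) (hh' : h ≤ 1 / 96) :
    ∃ T : ℝ, 0 < T ∧ ∀ c₁ : ℝ,
      ∀ (f : EuclideanSpace ℝ (Fin n) → ℝ → ℝ) (u : EuclideanSpace ℝ (Fin n) → ℝ),
      IsViscositySolution f (Metric.ball 0 1) u →
      (∀ x ∈ Metric.ball (0 : EuclideanSpace ℝ (Fin n)) 1, 0 ≤ u x) →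
      ∀ x₀ ∈ freeBoundaryHalf u, IsHardyHenonSource f x₀ α m c₁ c₂ →
      ∀ y z : EuclideanSpace ℝ (Fin n), ‖y‖ + 4 * h < 1 → 1 / 12 < ‖y - x₀‖ → ‖z - y‖ = h →
      u y ≤ max T (4 * u z) := by
  have hq : 0 < 3 - m := by linarith
  -- The barrier exponent is σ = 3/2, and 512 = 384 / (σ(σ - 1)). On the ball of radius 4h ≤ 1/24
  -- around y the weight is at most 24^|α| for either sign of α.
  set Q : ℝ := c₂ * 24 ^ |α| * h ^ (2 + (3 / 2 : ℝ)) * 512 with hQ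
  have hQ0 : 0 < Q := by positivity
  refine ⟨Q ^ (3 - m)⁻¹, by positivity, ?_⟩
  intro c₁ f u hu hu0 x₀ hx₀ hf y z hy hyx hzy
  rw [le_max_iff, or_iff_not_imp_left, not_le]
  intro hcon
  have hx₀h : ‖x₀‖ < 1 / 2 := by simpa using hx₀.1
  have hsub4 : Metric.closedBall y (4 * h) ⊆ Metric.ball 0 1 := by
    intro w hw
    have hw' : ‖w - y‖ ≤ 4 * h := by simpa [dist_eq_norm] using hw
    have h1 := norm_le_norm_add_norm_sub' w y
    rw [mem_ball_zero_iff]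
    linarith
  have hS : 0 < u y := lt_of_le_of_lt (by positivity) hcon
  have hSq := lt_rpow_of_rpow_inv_lt (by positivity) hq hcon
  have hSm : 0 < u y ^ m := Real.rpow_pos_of_pos hS m
  have hK : c₂ * 24 ^ |α| * u y ^ m
      < (3 / 2) * (3 / 2 - 1) / 384 * u y ^ 3 / h ^ (2 + (3 / 2 : ℝ)) := by
    rw [lt_div_iff₀ (by positivity)]
    have e2 : u y ^ 3 = u y ^ (3 - m) * u y ^ m := by
      rw [← Real.rpow_add hS, sub_add_cancel]
      norm_cast
    calc c₂ * 24 ^ |α| * u y ^ m * h ^ (2 + (3 / 2 : ℝ)) = Q * u y ^ m / 512 := by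
          rw [hQ]; ring
      _ < u y ^ (3 - m) * u y ^ m / 512 := by gcongr
      _ = (3 / 2) * (3 / 2 - 1) / 384 * u y ^ 3 := by rw [e2]; ring
  have := le_of_dist_eq_of_supersolution (F := fun z => f z (u z)) hh
    (by norm_num : (1 : ℝ) < 3 / 2) (by norm_num) (hu.continuousOn.mono hsub4)
    (fun w hw => hu0 w (hsub4 hw)) hS
    (fun w hw _ φ hφ hmin => hu.super w (hsub4 (Metric.ball_subset_closedBall hw)) φ hφ hmin)
    (fun w hw hwS hwd => ?_) hK hzy
  · linarith
  have hw1 := hsub4 (Metric.ball_subset_closedBall hw)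
  have hw4 : ‖w - y‖ < 4 * h := by simpa [dist_eq_norm] using hw
  have hρ24 : 1 / 24 ≤ ‖w - x₀‖ := by
    have h1 := norm_sub_le_norm_sub_add_norm_sub y w x₀
    rw [norm_sub_rev y w] at h1
    linarith
  have hρ : 0 < ‖w - x₀‖ := by linarith
  have hρ2 : ‖w - x₀‖ ≤ 24 := by
    have h1 := norm_sub_le w x₀
    have h2 : ‖w‖ < 1 := by simpa using hw1
    linarith
  have hwx : w ≠ x₀ := sub_ne_zero.1 (norm_pos_iff.1 hρ)
  have hα : ‖w - x₀‖ ^ α ≤ 24 ^ |α| := by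
    rcases le_total 0 α with h0 | h0
    · rw [abs_of_nonneg h0]
      exact Real.rpow_le_rpow hρ.le hρ2 h0
    · rw [abs_of_nonpos h0, Real.rpow_neg (by norm_num), ← Real.inv_rpow (by norm_num)]
      exact Real.rpow_le_rpow_of_nonpos (by norm_num) (by linarith) h0
  -- As |‖w - y‖ - h| ≤ 3h < 1, the singular factor only helps a bounded source.
  have h1 : 1 ≤ |‖w - y‖ - h| ^ ((3 / 2 : ℝ) - 2) := by
    refine Real.one_le_rpow_of_pos_of_le_one_of_nonpos (abs_pos.2 (sub_ne_zero.2 hwd)) ?_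
      (by norm_num)
    exact abs_le.2 ⟨by linarith [norm_nonneg (w - y)], by linarith⟩
  have hwn := hu0 w hw1
  calc f w (u w) ≤ c₂ * (‖w - x₀‖ ^ α * u w ^ m) := hf.le_of_nonneg hw1 hwx hwn
    _ ≤ c₂ * (24 ^ |α| * u y ^ m) := by gcongr
    _ = c₂ * 24 ^ |α| * u y ^ m * 1 := by ring
    _ ≤ _ := by gcongr

/-- Universal interior bound, independent of the size of `u`. -/
theorem exists_interior_bound {n : ℕ} (hn : 1 ≤ n) {m α c₂ η : ℝ} (hm0 : 0 ≤ m) (hm3 : m < 3)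
    (hα : -(4 / 3) * m < α) (hc₂ : 0 < c₂) (hη : 0 < η) :
    ∃ C : ℝ, 0 < C ∧ ∀ c₁ : ℝ, 0 < c₁ →
      ∀ (f : EuclideanSpace ℝ (Fin n) → ℝ → ℝ) (u : EuclideanSpace ℝ (Fin n) → ℝ),
      IsViscositySolution f (Metric.ball 0 1) u →
      (∀ x ∈ Metric.ball (0 : EuclideanSpace ℝ (Fin n)) 1, 0 ≤ u x) →
      ∀ x₀ ∈ freeBoundaryHalf u, IsHardyHenonSource f x₀ α m c₁ c₂ → ‖x₀‖ ≤ 1 - η →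
      ∀ x, ‖x‖ ≤ 1 - η → ‖x - x₀‖ ≤ 1 / 2 → u x ≤ C := by
  obtain ⟨h, hh, hh96, hhη⟩ : ∃ h : ℝ, 0 < h ∧ h ≤ 1 / 96 ∧ 4 * h < η :=
    ⟨min (1 / 96) (η / 8), lt_min (by norm_num) (by linarith), min_le_left _ _, by
      linarith [min_le_right (1 / 96) (η / 8)]⟩
  obtain ⟨T, hT, hstep⟩ := exists_harnack_threshold (n := n) (α := α) hm0 hm3 hc₂ hh hh96
  obtain ⟨C₀, hC₀, hnear⟩ := exists_growth_bound hn hm0 hm3 hα hc₂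
  have hchain : ∀ k : ℕ, ∃ C : ℝ, 0 < C ∧ ∀ c₁ : ℝ, 0 < c₁ →
      ∀ (f : EuclideanSpace ℝ (Fin n) → ℝ → ℝ) (u : EuclideanSpace ℝ (Fin n) → ℝ),
      IsViscositySolution f (Metric.ball 0 1) u →
      (∀ x ∈ Metric.ball (0 : EuclideanSpace ℝ (Fin n)) 1, 0 ≤ u x) →
      ∀ x₀ ∈ freeBoundaryHalf u, IsHardyHenonSource f x₀ α m c₁ c₂ → ‖x₀‖ ≤ 1 - η →
      ∀ x, ‖x‖ ≤ 1 - η → ‖x - x₀‖ ≤ 1 / 12 + k * h → u x ≤ C := by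
    intro k
    induction k with
    | zero =>
      refine ⟨C₀ * (1 / 12) ^ ((4 + α) / (3 - m)), by positivity, ?_⟩
      intro c₁ hc₁ f u hu hu0 x₀ hx₀ hf _ x _ hx
      exact hnear c₁ hc₁ f u hu hu0 x₀ hx₀ hf (1 / 12) (by norm_num) le_rfl x
        (by simpa [dist_eq_norm] using hx)
    | succ k ih =>
      obtain ⟨C, hC, hk⟩ := ih
      refine ⟨max C (max T (4 * C)), lt_max_of_lt_left hC, ?_⟩
      intro c₁ hc₁ f u hu hu0 x₀ hx₀ hf hx₀η x hxη hx
      rcases le_or_gt ‖x - x₀‖ (1 / 12 + k * h) with hle | hgt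
      · exact (hk c₁ hc₁ f u hu hu0 x₀ hx₀ hf hx₀η x hxη hle).trans (le_max_left _ _)
      have hD : 1 / 12 < ‖x - x₀‖ := lt_of_le_of_lt (by nlinarith [k.cast_nonneg (α := ℝ)]) hgt
      have hD0 : 0 < ‖x - x₀‖ := by linarith
      set θ := h / ‖x - x₀‖ with hθ
      have hθ0 : 0 < θ := by positivity
      have hθ1 : θ < 1 := by rw [hθ, div_lt_one hD0]; linarith
      have hθD : θ * ‖x - x₀‖ = h := by rw [hθ]; field_simp
      -- One step of length h towards x₀; convexity keeps z in the ball of radius 1 - η.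
      set z := (1 - θ) • x + θ • x₀ with hz
      have hzx : ‖z - x‖ = h := by
        rw [show z - x = -(θ • (x - x₀)) by rw [hz]; module, norm_neg, norm_smul,
          Real.norm_of_nonneg hθ0.le, hθD]
      have hzx₀ : ‖z - x₀‖ ≤ 1 / 12 + k * h := by
        rw [show z - x₀ = (1 - θ) • (x - x₀) by rw [hz]; module, norm_smul,
          Real.norm_of_nonneg (by linarith), sub_mul, hθD]
        push_cast at hx
        linarith
      have hzη : ‖z‖ ≤ 1 - η := by
        have := convex_closedBall (0 : EuclideanSpace ℝ (Fin n)) (1 - η)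
          (mem_closedBall_zero_iff.2 hxη) (mem_closedBall_zero_iff.2 hx₀η)
          (by linarith : 0 ≤ 1 - θ) hθ0.le (by ring)
        exact mem_closedBall_zero_iff.1 this
      have h1 := hstep c₁ f u hu hu0 x₀ hx₀ hf x z (by linarith) hD hzx
      have h2 := hk c₁ hc₁ f u hu hu0 x₀ hx₀ hf hx₀η z hzη hzx₀
      refine h1.trans (le_max_of_le_right ?_)
      gcongr
  -- The number of steps depends only on h, hence only on η.
  obtain ⟨k, hk⟩ := exists_nat_ge (1 / 2 / h)
  obtain ⟨C, hC, hbound⟩ := hchain k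
  refine ⟨C, hC, fun c₁ hc₁ f u hu hu0 x₀ hx₀ hf hx₀η x hxη hx => ?_⟩
  refine hbound c₁ hc₁ f u hu hu0 x₀ hx₀ hf hx₀η x hxη (hx.trans ?_)
  rw [div_le_iff₀ hh] at hk
  linarith

/-! ### Large radii and conclusion. -/

/-- For r ≥ 1/12 one has (12 r)^β ≥ 1, so a plain bound already has the required form. -/
theorem le_mul_rpow_of_le {v A r β : ℝ} (hβ : 0 ≤ β) (hA : 0 < A) (hv : v ≤ A)
    (hr : 1 / 12 ≤ r) : v ≤ A * 12 ^ β * r ^ β := by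
  rw [mul_assoc, ← Real.mul_rpow (by norm_num) (by linarith)]
  exact hv.trans (le_mul_of_one_le_right hA.le (Real.one_le_rpow (by linarith) hβ))

theorem theorem1p1 (n : ℕ) (hn : 2 ≤ n) (m α : ℝ) (hm0 : 0 ≤ m) (hm3 : m < 3)
    (hα : -(4 / 3) * m < α) (c₂ : ℝ) (hc₂ : 0 < c₂) :
    (∀ η : ℝ, 0 < η → ∃ C : ℝ, 0 < C ∧
      ∀ c₁ : ℝ, 0 < c₁ →
      ∀ (f : EuclideanSpace ℝ (Fin n) → ℝ → ℝ) (u : EuclideanSpace ℝ (Fin n) → ℝ),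
      IsViscositySolution f (Metric.ball 0 1) u →
      (∀ x ∈ Metric.ball (0 : EuclideanSpace ℝ (Fin n)) 1, 0 ≤ u x) →
      ∀ x₀ ∈ freeBoundaryHalf u, IsHardyHenonSource f x₀ α m c₁ c₂ →
      ∀ r : ℝ, 0 < r → r < 1 / 2 → ‖x₀‖ + r ≤ 1 - η →
      ∀ x ∈ Metric.ball x₀ r, u x ≤ C * r ^ ((4 + α) / (3 - m))) ∧
    (∀ M : ℝ, 0 < M → ∃ C : ℝ, 0 < C ∧
      ∀ c₁ : ℝ, 0 < c₁ →
      ∀ (f : EuclideanSpace ℝ (Fin n) → ℝ → ℝ) (u : EuclideanSpace ℝ (Fin n) → ℝ),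
      IsViscositySolution f (Metric.ball 0 1) u →
      (∀ x ∈ Metric.ball (0 : EuclideanSpace ℝ (Fin n)) 1, 0 ≤ u x ∧ u x ≤ M) →
      ∀ x₀ ∈ freeBoundaryHalf u, IsHardyHenonSource f x₀ α m c₁ c₂ →
      ∀ r : ℝ, 0 < r → r < 1 / 2 →
      ∀ x ∈ Metric.ball x₀ r, u x ≤ C * r ^ ((4 + α) / (3 - m))) := by
  -- α > -4m/3 > -4 because m < 3.
  have hβ : 0 ≤ (4 + α) / (3 - m) := div_nonneg (by linarith) (by linarith)
  obtain ⟨C₀, hC₀, hnear⟩ := exists_growth_bound (by omega : 1 ≤ n) hm0 hm3 hα hc₂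
  constructor
  · intro η hη
    obtain ⟨A, hA, hfar⟩ := exists_interior_bound (by omega : 1 ≤ n) hm0 hm3 hα hc₂ hη
    refine ⟨max C₀ (A * 12 ^ ((4 + α) / (3 - m))), lt_max_of_lt_left hC₀, ?_⟩
    intro c₁ hc₁ f u hu hu0 x₀ hx₀ hf r hr hr2 hrη x hx
    rcases le_total r (1 / 12) with h | h
    · refine (hnear c₁ hc₁ f u hu hu0 x₀ hx₀ hf r hr h x
        (Metric.ball_subset_closedBall hx)).trans ?_
      gcongr
      exact le_max_left _ _
    · have hxr : ‖x - x₀‖ < r := by simpa [dist_eq_norm] using hx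
      have hxn := norm_le_norm_add_norm_sub' x x₀
      refine (le_mul_rpow_of_le hβ hA (hfar c₁ hc₁ f u hu hu0 x₀ hx₀ hf (by linarith) x
        (by linarith) (by linarith)) h).trans ?_
      gcongr
      exact le_max_right _ _
  · intro M hM
    refine ⟨max C₀ (M * 12 ^ ((4 + α) / (3 - m))), lt_max_of_lt_left hC₀, ?_⟩
    intro c₁ hc₁ f u hu hu0 x₀ hx₀ hf r hr hr2 x hx
    rcases le_total r (1 / 12) with h | h
    · refine (hnear c₁ hc₁ f u hu (fun x hx => (hu0 x hx).1) x₀ hx₀ hf r hr h x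
        (Metric.ball_subset_closedBall hx)).trans ?_
      gcongr
      exact le_max_left _ _
    · have hxr : ‖x - x₀‖ < r := by simpa [dist_eq_norm] using hx
      have hxn := norm_le_norm_add_norm_sub' x x₀
      have hx₀h : ‖x₀‖ < 1 / 2 := by simpa using hx₀.1
      refine (le_mul_rpow_of_le hβ hM (hu0 x (by
        rw [mem_ball_zero_iff]; linarith)).2 h).trans ?_
      gcongr
      exact le_max_right _ _
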